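/- All curves are $C^\infty$ curves in Euclidean 3-space, parametrized by arc length on intervals of $\mathbb R$ with more than one point (derivatives are one-sided at endpoints that belong to the interval). For a curve $\varphi$ put $T_\varphi=\varphi'$, $N_\varphi=T_\varphi'$, $B_\varphi=T_\varphi\times N_\varphi$ (the modified orthogonal frame). The principal normal and the binormal of $\varphi$ are well defined at $s$ when $N_\varphi(s)\neq 0$, and are then spanned by $N_\varphi(s)$ and $B_\varphi(s)$. A Frenet frame of $\varphi$ is a $C^\infty$ right-handed orthonormal frame $(T_\varphi,n,b)$ with $T_\varphi'=\kappa n$, $n'=-\kappa T_\varphi+\tau b$, $b'=-\tau n$ for some $C^\infty$ functions $\kappa,\tau$; here $\kappa$ may vanish and change sign, and $N_\varphi=\kappa n$, $B_\varphi=\kappa b$. A curve with a Frenet frame is a Frenet curve. A curve $\psi:I^*\to\mathbb R^3$ is a *weakened Mannheim (WM) curve* if there are a curve $\varphi:I\to\mathbb R^3$, a homeomorphism $\rho:I\to I^*$, written $s^*=\rho(s)$, with $\psi\circ\rho\not\equiv\varphi$, and disjoint relatively closed subsets $M,N$ of $I$ with empty interiors, such that (i) $\rho$ is $C^\infty$ on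 $I\setminus N$ with $ds^*/ds=0$ on $M$, and $\rho^{-1}$ is $C^\infty$ on $\rho(I\setminus M)$ with $ds/ds^*=0$ on $\rho(N)$; (ii) for every $s\in I$ the vector $\psi(\rho(s))-\varphi(s)$ is orthogonal to $T_\varphi(s)$ and to $T_\psi(\rho(s))$, is along the binormal of $\varphi$ at $s$ if that is well defined, and is along the principal normal of $\psi$ at $\rho(s)$ if that is well defined. A Frenet curve $\psi:I^*\to\mathbb R^3$ is a *Frenet–Mannheim (FM) curve* if there are a Frenet curve $\varphi:I\to\mathbb R^3$ and a $C^\infty$ diffeomorphism $\rho:I\to I^*$ (so $\rho'\neq0$) such that $\psi(\rho(s))\ne\varphi(s)$ for all $s\in I$ and, for suitable Frenet frames, the vector $\psi(\rho(s))-\varphi(s)$ is for every $s \in I$ a multiple of the unit binormal vector of $\varphi$ at $s$ and of the unit principal normal vector of $\psi$ at $\rho(s)$. The dense-in-itself kernel of a set is its largest subset without isolated points. **Theorem.** Let $\psi$ be a WM curve, with $\varphi,\rho,M,N$ as above, and suppose that $M$ and $N$ have empty dense-in-itself kernels. Then $\psi$ is an FM curve. In fact $M=N=\varnothing$, and there are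 a constant $a\neq0$ and a Frenet frame $(T_\varphi,n,b)$ of $\varphi$ on $I$, with curvature function $\kappa_\varphi$, such that $\psi(\rho(s))=\varphi(s)+a\,b(s)$ for all $s\in I$. Equivalently, in terms of the modified frame, the coefficient $\delta$ in $\psi(\rho(s))=\varphi(s)+\delta(s)B_\varphi(s)$ exists, is unique and equals $a/\kappa_\varphi(s)$ at every $s\in I$ with $\kappa_\varphi(s)\ne0$ (where $\kappa_\varphi(s)=0$ one has $B_\varphi(s)=0$, and the relation reads $\psi(\rho(s))=\varphi(s)+a\,b(s)$). -/

import Mathlib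

open scoped ContDiff

noncomputable section

namespace Mannheim

/-- Euclidean 3-space. -/
abbrev E3 := EuclideanSpace ℝ (Fin 3)

/-- The vector product of Euclidean 3-space. -/
def cross (u v : E3) : E3 := WithLp.toLp 2 (crossProduct u.ofLp v.ofLp)

/-- The dense-in-itself kernel of a set of reals: its largest dense-in-itself subset, that is, the
union of all subsets without isolated points (`Preperfect A` says that every point of `A` is an
accumulation point of `A`). -/
def denseInItselfKernel (S : Set ℝ) : Set ℝ := ⋃₀ {A | A ⊆ S ∧ Preperfect A}

/-- A proper interval: an interval (open or not at each end, bounded or not) with more than one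
point. -/
def IsProperInterval (I : Set ℝ) : Prop := I.OrdConnected ∧ I.Nontrivial

/-- The tangent vector `T = dφ/ds` of a curve defined on `I` (one-sided at endpoints in `I`). -/
def tangent (I : Set ℝ) (φ : ℝ → E3) (s : ℝ) : E3 := derivWithin φ I s

/-- The vector `N = dT/ds` of the modified orthogonal frame. For an arc length parameter it spans
the principal normal where it is nonzero; where it is zero the principal normal is not well
defined. -/
def modNormal (I : Set ℝ) (φ : ℝ → E3) (s : ℝ) : E3 := derivWithin (tangent I φ) I s

/-- The vector `B = T × N` of the modified orthogonal frame. For an arc length parameter it is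
nonzero exactly where `N` is, and it spans the binormal there. -/
def modBinormal (I : Set ℝ) (φ : ℝ → E3) (s : ℝ) : E3 := cross (tangent I φ s) (modNormal I φ s)

/-- A smooth regular curve on a proper interval `I`, parametrized by arc length. -/
structure IsRegularCurve (I : Set ℝ) (φ : ℝ → E3) : Prop where
  interval : IsProperInterval I
  smooth : ContDiffOn ℝ ∞ φ I
  unit_speed : ∀ s ∈ I, ‖tangent I φ s‖ = 1

/-- `ρ : I → J` is a homeomorphism with inverse `σ : J → I`. -/
structure IsHomeoOn (I J : Set ℝ) (ρ σ : ℝ → ℝ) : Prop where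
  mapsTo : Set.MapsTo ρ I J
  mapsTo_inv : Set.MapsTo σ J I
  left_inv : ∀ s ∈ I, σ (ρ s) = s
  right_inv : ∀ t ∈ J, ρ (σ t) = t
  cont : ContinuousOn ρ I
  cont_inv : ContinuousOn σ J

/-- A smooth family of Frenet frames `(T, n, b)` along an arc length curve: right-handed,
orthonormal, and satisfying the Frenet-Serret equations with smooth scalar functions `κ` (which may
vanish and change sign) and `τ`. -/
structure IsFrenetFrame (I : Set ℝ) (φ n b : ℝ → E3) (κ τ : ℝ → ℝ) : Prop where
  smooth_n : ContDiffOn ℝ ∞ n I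
  smooth_b : ContDiffOn ℝ ∞ b I
  smooth_κ : ContDiffOn ℝ ∞ κ I
  smooth_τ : ContDiffOn ℝ ∞ τ I
  norm_n : ∀ s ∈ I, ‖n s‖ = 1
  orth : ∀ s ∈ I, inner ℝ (tangent I φ s) (n s) = 0
  binormal_eq : ∀ s ∈ I, b s = cross (tangent I φ s) (n s)
  deriv_T : ∀ s ∈ I, derivWithin (tangent I φ) I s = κ s • n s
  deriv_n : ∀ s ∈ I, derivWithin n I s = -(κ s) • tangent I φ s + τ s • b s
  deriv_b : ∀ s ∈ I, derivWithin b I s = -(τ s) • n s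

/-- The Frenet curve `φ` on `I` is a Frenet-Mannheim conjugate of the Frenet curve `ψ` on `J`, the
point `φ s` corresponding to `ψ (ρ s)`: for suitable Frenet frames the binormal vector of `φ` and
the principal normal vector of `ψ` both lie on the line that joins corresponding points. -/
structure IsFMConjugate (J : Set ℝ) (ψ : ℝ → E3) (I : Set ℝ) (φ : ℝ → E3) (ρ σ : ℝ → ℝ) :
    Prop where
  regular_φ : IsRegularCurve I φ
  regular_ψ : IsRegularCurve J ψ
  homeo : IsHomeoOn I J ρ σ
  smooth : ContDiffOn ℝ ∞ ρ I
  smooth_inv : ContDiffOn ℝ ∞ σ J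
  deriv_ne_zero : ∀ s ∈ I, derivWithin ρ I s ≠ 0
  distinct : ∀ s ∈ I, ψ (ρ s) ≠ φ s
  frames : ∃ (nφ bφ nψ bψ : ℝ → E3) (κφ τφ κψ τψ : ℝ → ℝ),
    IsFrenetFrame I φ nφ bφ κφ τφ ∧ IsFrenetFrame J ψ nψ bψ κψ τψ ∧
    ∀ s ∈ I, (∃ c : ℝ, ψ (ρ s) - φ s = c • bφ s) ∧ (∃ c : ℝ, ψ (ρ s) - φ s = c • nψ (ρ s))

/-- `ψ`, defined on `J`, is a Frenet-Mannheim curve. -/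
def IsFMCurve (J : Set ℝ) (ψ : ℝ → E3) : Prop :=
  ∃ (I : Set ℝ) (φ : ℝ → E3) (ρ σ : ℝ → ℝ), IsFMConjugate J ψ I φ ρ σ

/-- The regular curve `ψ` on `J` is a weakened Mannheim curve, with WM conjugate the regular curve
`φ` on `I`, correspondence `ρ` (with inverse `σ`) and exceptional sets `M` and `N`. -/
structure IsWMPair (J : Set ℝ) (ψ : ℝ → E3) (I : Set ℝ) (φ : ℝ → E3) (ρ σ : ℝ → ℝ)
    (M N : Set ℝ) : Prop where
  regular_φ : IsRegularCurve I φ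
  regular_ψ : IsRegularCurve J ψ
  homeo : IsHomeoOn I J ρ σ
  /-- `φ` is another curve than `ψ`: not all corresponding points coincide. -/
  distinct : ∃ s ∈ I, ψ (ρ s) ≠ φ s
  M_subset : M ⊆ I
  N_subset : N ⊆ I
  /-- `M` is closed in `I`. -/
  M_closed : ∃ F : Set ℝ, IsClosed F ∧ M = F ∩ I
  /-- `N` is closed in `I`. -/
  N_closed : ∃ F : Set ℝ, IsClosed F ∧ N = F ∩ I
  disjoint : Disjoint M N
  M_interior : interior M = ∅
  N_interior : interior N = ∅
  smooth : ContDiffOn ℝ ∞ ρ (I \ N)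
  deriv_M : ∀ s ∈ M, derivWithin ρ I s = 0
  smooth_inv : ContDiffOn ℝ ∞ σ (ρ '' (I \ M))
  deriv_N : ∀ t ∈ ρ '' N, derivWithin σ J t = 0
  /-- The joining line is orthogonal to `φ`. -/
  orth_φ : ∀ s ∈ I, inner ℝ (ψ (ρ s) - φ s) (tangent I φ s) = 0
  /-- The joining line is orthogonal to `ψ`. -/
  orth_ψ : ∀ s ∈ I, inner ℝ (ψ (ρ s) - φ s) (tangent J ψ (ρ s)) = 0
  /-- The joining line is along the binormal of `φ` wherever that is well defined. -/
  along_φ : ∀ s ∈ I, modNormal I φ s ≠ 0 → ∃ c : ℝ, ψ (ρ s) - φ s = c • modBinormal I φ s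
  /-- The joining line is along the principal normal of `ψ` wherever that is well defined. -/
  along_ψ : ∀ s ∈ I, modNormal J ψ (ρ s) ≠ 0 → ∃ c : ℝ, ψ (ρ s) - φ s = c • modNormal J ψ (ρ s)

end Mannheim

end

/-!
Write `v = ψ ∘ ρ - φ` for the joining vector and `T`, `T*` for the unit tangents of `φ`, `ψ`.

*The set `M` is empty.* The vector `v` is orthogonal to `T`, and it is orthogonal to `T' = N_φ`
everywhere: where `N_φ ≠ 0` because `v` is along `T × N_φ`, and elsewhere trivially. Differentiating
`⟨v, T⟩ = 0` where `ρ` is differentiable gives `ρ' ⟨T*, T⟩ = 1`, so `ρ'` has no zero off `N`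
(`IsWMPair.derivWithin_mul_inner_tangent`). Hence `σ = ρ⁻¹` is smooth on all of `J`.

*The set `N` is empty.* On `J` the joining vector is `w = ψ - φ ∘ σ`. It has constant length, since
`⟨w, w'⟩ = ⟨w, T* - σ' T⟩ = 0`, and so it never vanishes; where `N_ψ ≠ 0`, it is a nonzero multiple
of `N_ψ`, so `⟨N_ψ, T⟩ = 0` everywhere. Differentiating `⟨w, T⟩ = 0` on `J` gives
`σ' = ⟨T*, T⟩`, and therefore `σ'' = ⟨T*, σ' N_φ⟩ + ⟨N_ψ, T⟩ = ⟨T*, N_φ⟩ σ'`, a linear homogeneous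
equation for `σ'` (`IsWMPair.derivWithin_inv_ne_zero`). As `N` is not all of `I`, `σ'` is
somewhere nonzero; by uniqueness for the equation (`eqOn_zero_of_derivWithin_eq_mul`) it vanishes
nowhere, which excludes points of `N`. So `ρ` is a diffeomorphism.

*The frames.* With `a = ‖v‖`, the unit field `v / a` is smooth and orthogonal to both tangents; it is
a Frenet binormal of `φ` because `T'` is orthogonal to it, and a Frenet principal normal of `ψ`
because `N_ψ` is a multiple of it. In dimension three this is all that the Frenet equations need
(`IsRegularCurve.isFrenetFrame`).
-/

open Set

namespace Mannheim

/-! ### The vector product -/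

lemma inner_eq_sum (u v : E3) : inner ℝ u v = u 0 * v 0 + u 1 * v 1 + u 2 * v 2 := by
  simp [PiLp.inner_apply, Fin.sum_univ_three]
  ring

lemma cross_zero_apply (u v : E3) : cross u v 0 = u 1 * v 2 - u 2 * v 1 := by
  simp [cross, cross_apply]

lemma cross_one_apply (u v : E3) : cross u v 1 = u 2 * v 0 - u 0 * v 2 := by
  simp [cross, cross_apply]

lemma cross_two_apply (u v : E3) : cross u v 2 = u 0 * v 1 - u 1 * v 0 := by
  simp [cross, cross_apply]

lemma inner_cross_left (u v : E3) : inner ℝ u (cross u v) = 0 := by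
  rw [inner_eq_sum, cross_zero_apply, cross_one_apply, cross_two_apply]
  ring

lemma inner_cross_right (u v : E3) : inner ℝ v (cross u v) = 0 := by
  rw [inner_eq_sum, cross_zero_apply, cross_one_apply, cross_two_apply]
  ring

lemma cross_smul (u v : E3) (k : ℝ) : cross u (k • v) = k • cross u v := by
  simp [cross]

lemma cross_cross_self (u v : E3) :
    cross u (cross v u) = inner ℝ u u • v - (inner ℝ u v : ℝ) • u := by
  rw [inner_eq_sum, inner_eq_sum]
  ext i
  fin_cases i <;>
    simp [cross_zero_apply, cross_one_apply, cross_two_apply] <;> ring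

lemma norm_cross {u v : E3} (hu : ‖u‖ = 1) (hv : ‖v‖ = 1) (huv : inner ℝ u v = 0) :
    ‖cross u v‖ = 1 := by
  have h1 : inner ℝ u u = 1 := by rw [real_inner_self_eq_norm_sq, hu, one_pow]
  have h2 : inner ℝ v v = 1 := by rw [real_inner_self_eq_norm_sq, hv, one_pow]
  -- Lagrange's identity for the vector product
  have h : inner ℝ (cross u v) (cross u v)
      = inner ℝ u u * inner ℝ v v - inner ℝ u v ^ 2 := by
    simp only [inner_eq_sum, cross_zero_apply, cross_one_apply, cross_two_apply]
    ring
  rw [h1, h2, huv, real_inner_self_eq_norm_sq] at h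
  exact (sq_eq_sq₀ (norm_nonneg _) zero_le_one).1 (by rw [h]; norm_num)

lemma eq_sum_inner_smul {u v : E3} (hu : ‖u‖ = 1) (hv : ‖v‖ = 1) (huv : inner ℝ u v = 0)
    (x : E3) :
    x = (inner ℝ u x : ℝ) • u + (inner ℝ v x : ℝ) • v
      + (inner ℝ (cross u v) x : ℝ) • cross u v := by
  have hon : Orthonormal ℝ ![u, v, cross u v] := by
    constructor
    · intro i
      fin_cases i
      · exact hu
      · exact hv
      · exact norm_cross hu hv huv
    · have h1 := inner_cross_left u v
      have h2 := inner_cross_right u v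
      intro i j hij
      fin_cases i <;> fin_cases j <;>
        simp_all [real_inner_comm (cross u v), real_inner_comm u v]
  have hspan := hon.linearIndependent.span_eq_top_of_card_eq_finrank (by simp)
  have h := (OrthonormalBasis.mk hon hspan.ge).sum_repr' x
  simpa [Fin.sum_univ_three] using h.symm

lemma contDiffOn_cross {S : Set ℝ} {f g : ℝ → E3} (hf : ContDiffOn ℝ ∞ f S)
    (hg : ContDiffOn ℝ ∞ g S) : ContDiffOn ℝ ∞ (fun s => cross (f s) (g s)) S := by
  rw [contDiffOn_euclidean] at hf hg ⊢
  intro i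
  fin_cases i
  · simp only [Fin.zero_eta, cross_zero_apply]
    exact ((hf 1).mul (hg 2)).sub ((hf 2).mul (hg 1))
  · simp only [Fin.mk_one, cross_one_apply]
    exact ((hf 2).mul (hg 0)).sub ((hf 0).mul (hg 2))
  · simp only [Fin.reduceFinMk, cross_two_apply]
    exact ((hf 0).mul (hg 1)).sub ((hf 1).mul (hg 0))

/-! ### Calculus on proper intervals -/

lemma IsProperInterval.interior_nonempty {I : Set ℝ} (hI : IsProperInterval I) :
    (interior I).Nonempty :=
  hI.1.convex.nontrivial_iff_nonempty_interior.1 hI.2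

lemma IsProperInterval.uniqueDiffOn {I : Set ℝ} (hI : IsProperInterval I) : UniqueDiffOn ℝ I :=
  uniqueDiffOn_convex hI.1.convex hI.interior_nonempty

lemma IsHomeoOn.image_eq {I J : Set ℝ} {ρ σ : ℝ → ℝ} (h : IsHomeoOn I J ρ σ) : ρ '' I = J :=
  h.mapsTo.image_subset.antisymm fun t ht => ⟨σ t, h.mapsTo_inv ht, h.right_inv t ht⟩

lemma _root_.ContDiffOn.hasDerivWithinAt {E : Type*} [NormedAddCommGroup E] [NormedSpace ℝ E]
    {I : Set ℝ} {f : ℝ → E} (hf : ContDiffOn ℝ ∞ f I) {s : ℝ} (hs : s ∈ I) :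
    HasDerivWithinAt f (derivWithin f I s) I s :=
  (hf.differentiableOn (by simp) s hs).hasDerivWithinAt

/-- If `⟨f, g⟩` is constant on `I`, the two terms of its derivative cancel. -/
lemma inner_add_inner_eq_zero {I : Set ℝ} (hI : IsProperInterval I) {f g : ℝ → E3} {f' g' : E3}
    {c s : ℝ} (hs : s ∈ I) (hf : HasDerivWithinAt f f' I s) (hg : HasDerivWithinAt g g' I s)
    (hc : ∀ x ∈ I, inner ℝ (f x) (g x) = c) : inner ℝ (f s) g' + inner ℝ f' (g s) = 0 :=
  (hI.uniqueDiffOn s hs).eq_deriv _ (hf.inner ℝ hg)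
    ((hasDerivWithinAt_const s I c).congr hc (hc s hs))

lemma eq_zero_of_derivWithin_eq_mul_of_le {J : Set ℝ} (hJ : J.OrdConnected) {c g : ℝ → ℝ}
    (hg : ContinuousOn g J) (hc : ∀ t ∈ J, HasDerivWithinAt c (g t * c t) J t)
    {t₀ t : ℝ} (ht₀ : t₀ ∈ J) (ht : t ∈ J) (h₀ : c t₀ = 0) (hle : t₀ ≤ t) : c t = 0 := by
  have hsub : Icc t₀ t ⊆ J := hJ.out ht₀ ht
  obtain ⟨K, hK⟩ := isCompact_Icc.exists_bound_of_continuousOn (hg.mono hsub)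
  refine eq_zero_of_abs_deriv_le_mul_abs_self_of_eq_zero_right (f' := fun x => g x * c x) (K := K)
    (fun x hx => ((hc x (hsub hx)).continuousWithinAt).mono hsub) (fun x hx => ?_) h₀
    (fun x hx => ?_) t (right_mem_Icc.2 hle)
  · exact (hc x (hsub (Ico_subset_Icc_self hx))).mono_of_mem_nhdsWithin
      (Filter.mem_of_superset (Icc_mem_nhdsGE_of_mem hx) hsub)
  · rw [norm_mul]
    exact mul_le_mul_of_nonneg_right (hK x (Ico_subset_Icc_self hx)) (norm_nonneg _)

/-- Uniqueness for the equation `c' = g c` on an interval, whose endpoints may belong to it. -/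
lemma eqOn_zero_of_derivWithin_eq_mul {J : Set ℝ} (hJ : J.OrdConnected) {c g : ℝ → ℝ}
    (hg : ContinuousOn g J) (hc : ∀ t ∈ J, HasDerivWithinAt c (g t * c t) J t)
    {t₀ : ℝ} (ht₀ : t₀ ∈ J) (h₀ : c t₀ = 0) : ∀ t ∈ J, c t = 0 := by
  intro t ht
  rcases le_total t₀ t with hle | hle
  · exact eq_zero_of_derivWithin_eq_mul_of_le hJ hg hc ht₀ ht h₀ hle
  -- the values to the left of `t₀` are reached by reflecting the line
  · have hmaps : MapsTo (fun x : ℝ => -x) (Neg.neg ⁻¹' J) J := fun x hx => hx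
    have key := eq_zero_of_derivWithin_eq_mul_of_le (J := Neg.neg ⁻¹' J) (c := fun x => c (-x))
      (g := fun x => -g (-x)) (t₀ := -t₀) (t := -t)
      (hJ.preimage_anti fun _ _ h => neg_le_neg h)
      ((hg.comp continuous_neg.continuousOn hmaps).neg)
      (fun x hx => by
        have h := (hc (-x) hx).scomp x (hasDerivWithinAt_neg x (Neg.neg ⁻¹' J)) hmaps
        simpa [Function.comp_def] using h)
      (by simpa using ht₀) (by simpa using ht) (by simpa using h₀) (neg_le_neg hle)
    simpa using key

/-! ### Frenet frames of regular curves -/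

section RegularCurve

variable {I : Set ℝ} {φ : ℝ → E3}

lemma IsRegularCurve.contDiffOn_tangent (h : IsRegularCurve I φ) :
    ContDiffOn ℝ ∞ (tangent I φ) I :=
  h.smooth.derivWithin h.interval.uniqueDiffOn (by simp)

lemma IsRegularCurve.contDiffOn_modNormal (h : IsRegularCurve I φ) :
    ContDiffOn ℝ ∞ (modNormal I φ) I :=
  h.contDiffOn_tangent.derivWithin h.interval.uniqueDiffOn (by simp)

lemma IsRegularCurve.hasDerivWithinAt (h : IsRegularCurve I φ) {s : ℝ} (hs : s ∈ I) :
    HasDerivWithinAt φ (tangent I φ s) I s :=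
  h.smooth.hasDerivWithinAt hs

lemma IsRegularCurve.hasDerivWithinAt_tangent (h : IsRegularCurve I φ) {s : ℝ} (hs : s ∈ I) :
    HasDerivWithinAt (tangent I φ) (modNormal I φ s) I s :=
  h.contDiffOn_tangent.hasDerivWithinAt hs

lemma IsRegularCurve.inner_tangent_self (h : IsRegularCurve I φ) {s : ℝ} (hs : s ∈ I) :
    inner ℝ (tangent I φ s) (tangent I φ s) = 1 := by
  rw [real_inner_self_eq_norm_sq, h.unit_speed s hs, one_pow]

/-- Derivatives of the members of a smooth orthonormal frame have a skew-symmetric matrix, so the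
Frenet equations only require that `T'` be everywhere a multiple of `n`. -/
lemma IsRegularCurve.isFrenetFrame (h : IsRegularCurve I φ) {n : ℝ → E3}
    (hn : ContDiffOn ℝ ∞ n I) (hn1 : ∀ s ∈ I, ‖n s‖ = 1)
    (horth : ∀ s ∈ I, inner ℝ (tangent I φ s) (n s) = 0)
    (hT : ∀ s ∈ I, ∃ k : ℝ, modNormal I φ s = k • n s) :
    IsFrenetFrame I φ n (fun s => cross (tangent I φ s) (n s))
      (fun s => inner ℝ (modNormal I φ s) (n s))
      (fun s => inner ℝ (derivWithin n I s) (cross (tangent I φ s) (n s))) := by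
  have hb := contDiffOn_cross h.contDiffOn_tangent hn
  have hnn : ∀ s ∈ I, inner ℝ (n s) (n s) = (1 : ℝ) := fun s hs => by
    rw [real_inner_self_eq_norm_sq, hn1 s hs, one_pow]
  have hTeq : ∀ s ∈ I, modNormal I φ s = (inner ℝ (modNormal I φ s) (n s) : ℝ) • n s := by
    intro s hs
    obtain ⟨k, hk⟩ := hT s hs
    rw [hk, real_inner_smul_left, hnn s hs, mul_one]
  refine ⟨hn, hb, h.contDiffOn_modNormal.inner ℝ hn,
    (hn.derivWithin h.interval.uniqueDiffOn (by simp)).inner ℝ hb, hn1, horth,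
    fun s _ => rfl, hTeq, fun s hs => ?_, fun s hs => ?_⟩
  · have hn' := hn.hasDerivWithinAt hs
    have h1 := inner_add_inner_eq_zero h.interval hs (h.hasDerivWithinAt_tangent hs) hn' horth
    have h2 := inner_add_inner_eq_zero h.interval hs hn' hn' hnn
    rw [real_inner_comm (n s)] at h2
    have h3 : inner ℝ (n s) (derivWithin n I s) = (0 : ℝ) := by linarith
    have h4 : inner ℝ (tangent I φ s) (derivWithin n I s)
        = -(inner ℝ (modNormal I φ s) (n s) : ℝ) := by linarith
    have := eq_sum_inner_smul (h.unit_speed s hs) (hn1 s hs) (horth s hs) (derivWithin n I s)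
    rw [h3, h4, zero_smul, add_zero,
      real_inner_comm (derivWithin n I s) (cross (tangent I φ s) (n s))] at this
    exact this
  · have hn' := hn.hasDerivWithinAt hs
    have hb' := hb.hasDerivWithinAt hs
    set b : ℝ → E3 := fun s => cross (tangent I φ s) (n s) with hbdef
    have hTb : ∀ x ∈ I, inner ℝ (tangent I φ x) (b x) = 0 := fun x _ => inner_cross_left _ _
    have hnb : ∀ x ∈ I, inner ℝ (n x) (b x) = 0 := fun x _ => inner_cross_right _ _
    have hbb : ∀ x ∈ I, inner ℝ (b x) (b x) = (1 : ℝ) := fun x hx => by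
      rw [real_inner_self_eq_norm_sq, norm_cross (h.unit_speed x hx) (hn1 x hx) (horth x hx),
        one_pow]
    have h1 := inner_add_inner_eq_zero h.interval hs (h.hasDerivWithinAt_tangent hs) hb' hTb
    have h2 := inner_add_inner_eq_zero h.interval hs hn' hb' hnb
    have h3 := inner_add_inner_eq_zero h.interval hs hb' hb' hbb
    rw [hTeq s hs, real_inner_smul_left, hnb s hs, mul_zero, add_zero] at h1
    rw [real_inner_comm (b s)] at h3
    have h4 : inner ℝ (b s) (derivWithin b I s) = (0 : ℝ) := by linarith
    have h5 : inner ℝ (n s) (derivWithin b I s) = -(inner ℝ (derivWithin n I s) (b s) : ℝ) := by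
      linarith
    have := eq_sum_inner_smul (h.unit_speed s hs) (hn1 s hs) (horth s hs) (derivWithin b I s)
    change _ = _ + (inner ℝ (b s) (derivWithin b I s) : ℝ) • b s at this
    rw [h1, h4, h5, zero_smul, zero_smul, zero_add, add_zero] at this
    exact this

/-- A smooth unit normal field to which `T'` is orthogonal is the binormal of a Frenet frame. -/
lemma IsRegularCurve.exists_isFrenetFrame_binormal (h : IsRegularCurve I φ) {b : ℝ → E3}
    (hb : ContDiffOn ℝ ∞ b I) (hb1 : ∀ s ∈ I, ‖b s‖ = 1)
    (hTb : ∀ s ∈ I, inner ℝ (b s) (tangent I φ s) = 0)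
    (hNb : ∀ s ∈ I, inner ℝ (b s) (modNormal I φ s) = 0) :
    ∃ (n b' : ℝ → E3) (κ τ : ℝ → ℝ), IsFrenetFrame I φ n b' κ τ ∧ ∀ s ∈ I, b' s = b s := by
  refine ⟨fun s => cross (b s) (tangent I φ s), _, _, _,
    h.isFrenetFrame (contDiffOn_cross hb h.contDiffOn_tangent)
      (fun s hs => norm_cross (hb1 s hs) (h.unit_speed s hs) (hTb s hs))
      (fun s _ => inner_cross_right _ _) (fun s hs =>
        ⟨inner ℝ (cross (b s) (tangent I φ s)) (modNormal I φ s), ?_⟩), fun s hs => ?_⟩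
  · have h1 := inner_add_inner_eq_zero h.interval hs (h.hasDerivWithinAt_tangent hs)
      (h.hasDerivWithinAt_tangent hs) fun x hx => h.inner_tangent_self hx
    rw [real_inner_comm (tangent I φ s)] at h1
    have h2 : inner ℝ (tangent I φ s) (modNormal I φ s) = (0 : ℝ) := by linarith
    have h3 := eq_sum_inner_smul (hb1 s hs) (h.unit_speed s hs) (hTb s hs) (modNormal I φ s)
    rw [hNb s hs, h2, zero_smul, zero_smul, zero_add, zero_add] at h3
    exact h3
  · rw [cross_cross_self, h.inner_tangent_self hs, real_inner_comm, hTb s hs, one_smul, zero_smul,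
      sub_zero]

end RegularCurve

/-! ### The correspondence of a weakened Mannheim pair -/

section WMPair

variable {I J M N : Set ℝ} {φ ψ : ℝ → E3} {ρ σ : ℝ → ℝ}

lemma IsWMPair.inner_modNormal (h : IsWMPair J ψ I φ ρ σ M N) {s : ℝ} (hs : s ∈ I) :
    inner ℝ (ψ (ρ s) - φ s) (modNormal I φ s) = 0 := by
  by_cases h0 : modNormal I φ s = 0
  · rw [h0, inner_zero_right]
  · obtain ⟨c, hc⟩ := h.along_φ s hs h0
    rw [hc, real_inner_smul_left, modBinormal, real_inner_comm, inner_cross_right, mul_zero]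

/-- Where `ρ` is smooth, `⟨T_φ, T_ψ⟩` is the inverse of `dρ/ds`. -/
lemma IsWMPair.derivWithin_mul_inner_tangent (h : IsWMPair J ψ I φ ρ σ M N) {s : ℝ} (hs : s ∈ I)
    (hsN : s ∉ N) : derivWithin ρ I s * inner ℝ (tangent J ψ (ρ s)) (tangent I φ s) = 1 := by
  obtain ⟨F, hF, rfl⟩ := h.N_closed
  -- `I \ N` is a neighbourhood of `s` in `I`
  have hnhds : I \ (F ∩ I) ∈ nhdsWithin s I := by
    have : s ∉ F := fun hsF => hsN ⟨hsF, hs⟩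
    filter_upwards [self_mem_nhdsWithin, mem_nhdsWithin_of_mem_nhds (hF.isOpen_compl.mem_nhds this)]
      with x hxI hxF using ⟨hxI, fun hx => hxF hx.1⟩
  have hρ : HasDerivWithinAt ρ (derivWithin ρ I s) I s :=
    ((h.smooth.differentiableOn (by simp) s ⟨hs, hsN⟩).mono_of_mem_nhdsWithin
      hnhds).hasDerivWithinAt
  have hv := ((h.regular_ψ.hasDerivWithinAt (h.homeo.mapsTo hs)).scomp s hρ h.homeo.mapsTo).sub
    (h.regular_φ.hasDerivWithinAt hs)
  have key := inner_add_inner_eq_zero h.regular_φ.interval hs hv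
    (h.regular_φ.hasDerivWithinAt_tangent hs) h.orth_φ
  simp only [Pi.sub_apply, Function.comp_apply] at key
  rw [h.inner_modNormal hs, inner_sub_left, real_inner_smul_left,
    h.regular_φ.inner_tangent_self hs] at key
  linarith

lemma IsWMPair.M_eq_empty (h : IsWMPair J ψ I φ ρ σ M N) : M = ∅ := by
  refine eq_empty_of_forall_notMem fun s hs => ?_
  have := h.derivWithin_mul_inner_tangent (h.M_subset hs) (h.disjoint.notMem_of_mem_left hs)
  rw [h.deriv_M s hs, zero_mul] at this
  exact zero_ne_one this

lemma IsWMPair.contDiffOn_inv (h : IsWMPair J ψ I φ ρ σ M N) : ContDiffOn ℝ ∞ σ J := by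
  have := h.smooth_inv
  rwa [h.M_eq_empty, sdiff_empty, h.homeo.image_eq] at this

lemma IsWMPair.hasDerivWithinAt_joining (h : IsWMPair J ψ I φ ρ σ M N) {t : ℝ} (ht : t ∈ J) :
    HasDerivWithinAt (fun t => ψ t - φ (σ t))
      (tangent J ψ t - derivWithin σ J t • tangent I φ (σ t)) J t :=
  (h.regular_ψ.hasDerivWithinAt ht).sub ((h.regular_φ.hasDerivWithinAt
    (h.homeo.mapsTo_inv ht)).scomp t (h.contDiffOn_inv.hasDerivWithinAt ht) h.homeo.mapsTo_inv)

lemma IsWMPair.inner_joining_tangent_left (h : IsWMPair J ψ I φ ρ σ M N) {t : ℝ} (ht : t ∈ J) :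
    inner ℝ (ψ t - φ (σ t)) (tangent I φ (σ t)) = 0 := by
  have := h.orth_φ _ (h.homeo.mapsTo_inv ht)
  rwa [h.homeo.right_inv t ht] at this

lemma IsWMPair.inner_joining_tangent_right (h : IsWMPair J ψ I φ ρ σ M N) {t : ℝ} (ht : t ∈ J) :
    inner ℝ (ψ t - φ (σ t)) (tangent J ψ t) = 0 := by
  have := h.orth_ψ _ (h.homeo.mapsTo_inv ht)
  rwa [h.homeo.right_inv t ht] at this

/-- The joining segment has constant nonzero length. -/
lemma IsWMPair.exists_norm_joining_eq (h : IsWMPair J ψ I φ ρ σ M N) :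
    ∃ a : ℝ, 0 < a ∧ ∀ t ∈ J, ‖ψ t - φ (σ t)‖ = a := by
  obtain ⟨s₀, hs₀, hne⟩ := h.distinct
  have ht₀ := h.homeo.mapsTo hs₀
  have hpos : 0 < ‖ψ (ρ s₀) - φ s₀‖ := norm_pos_iff.2 (sub_ne_zero.2 hne)
  refine ⟨_, hpos, fun t ht => ?_⟩
  have key := eqOn_zero_of_derivWithin_eq_mul h.regular_ψ.interval.1 (g := fun _ => 0)
    (c := fun t => inner ℝ (ψ t - φ (σ t)) (ψ t - φ (σ t)) - ‖ψ (ρ s₀) - φ s₀‖ ^ 2)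
    continuousOn_const
    (fun x hx => by
      have hw := h.hasDerivWithinAt_joining hx
      refine ((hw.inner ℝ hw).sub_const _).congr_deriv ?_
      rw [real_inner_comm (ψ x - φ (σ x)) (tangent J ψ x - _), inner_sub_right,
        real_inner_smul_right, h.inner_joining_tangent_left hx, h.inner_joining_tangent_right hx]
      ring)
    ht₀ (by simp only [h.homeo.left_inv s₀ hs₀, real_inner_self_eq_norm_sq, sub_self]) t ht
  rw [real_inner_self_eq_norm_sq] at key
  exact (sq_eq_sq₀ (norm_nonneg _) hpos.le).1 (sub_eq_zero.1 key)

lemma IsWMPair.joining_ne_zero (h : IsWMPair J ψ I φ ρ σ M N) {t : ℝ} (ht : t ∈ J) :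
    ψ t - φ (σ t) ≠ 0 := by
  obtain ⟨a, ha, hnorm⟩ := h.exists_norm_joining_eq
  rw [← norm_pos_iff, hnorm t ht]
  exact ha

lemma IsWMPair.exists_modNormal_eq_smul (h : IsWMPair J ψ I φ ρ σ M N) {t : ℝ} (ht : t ∈ J) :
    ∃ k : ℝ, modNormal J ψ t = k • (ψ t - φ (σ t)) := by
  by_cases h0 : modNormal J ψ t = 0
  · exact ⟨0, by rw [h0, zero_smul]⟩
  · obtain ⟨c, hc⟩ := h.along_ψ (σ t) (h.homeo.mapsTo_inv ht) (by rwa [h.homeo.right_inv t ht])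
    rw [h.homeo.right_inv t ht] at hc
    have hc0 : c ≠ 0 := by
      rintro rfl
      exact h.joining_ne_zero ht (by rw [hc, zero_smul])
    exact ⟨c⁻¹, by rw [hc, smul_smul, inv_mul_cancel₀ hc0, one_smul]⟩

lemma IsWMPair.derivWithin_inv_eq_inner (h : IsWMPair J ψ I φ ρ σ M N) {t : ℝ} (ht : t ∈ J) :
    derivWithin σ J t = inner ℝ (tangent J ψ t) (tangent I φ (σ t)) := by
  have hσt := h.homeo.mapsTo_inv ht
  have hT := (h.regular_φ.hasDerivWithinAt_tangent hσt).scomp t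
    (h.contDiffOn_inv.hasDerivWithinAt ht) h.homeo.mapsTo_inv
  have key := inner_add_inner_eq_zero h.regular_ψ.interval ht (h.hasDerivWithinAt_joining ht) hT
    fun x hx => h.inner_joining_tangent_left hx
  have hN := h.inner_modNormal hσt
  rw [h.homeo.right_inv t ht] at hN
  rw [Function.comp_apply, real_inner_smul_right, hN, inner_sub_left, real_inner_smul_left,
    h.regular_φ.inner_tangent_self hσt] at key
  linarith

/-- The derivative of the inverse correspondence satisfies `σ'' = ⟨T_ψ, N_φ ∘ σ⟩ σ'` and is nonzero
somewhere, hence everywhere. -/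
lemma IsWMPair.derivWithin_inv_ne_zero (h : IsWMPair J ψ I φ ρ σ M N) {t : ℝ} (ht : t ∈ J) :
    derivWithin σ J t ≠ 0 := by
  intro h0
  have hzero := eqOn_zero_of_derivWithin_eq_mul h.regular_ψ.interval.1
    (c := fun t => inner ℝ (tangent J ψ t) (tangent I φ (σ t)))
    (g := fun t => inner ℝ (tangent J ψ t) (modNormal I φ (σ t)))
    (h.regular_ψ.contDiffOn_tangent.continuousOn.inner
      (h.regular_φ.contDiffOn_modNormal.continuousOn.comp h.homeo.cont_inv h.homeo.mapsTo_inv))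
    (fun x hx => by
      have hσx := h.homeo.mapsTo_inv hx
      have hT := (h.regular_φ.hasDerivWithinAt_tangent hσx).scomp x
        (h.contDiffOn_inv.hasDerivWithinAt hx) h.homeo.mapsTo_inv
      refine ((h.regular_ψ.hasDerivWithinAt_tangent hx).inner ℝ hT).congr_deriv ?_
      obtain ⟨k, hk⟩ := h.exists_modNormal_eq_smul hx
      rw [hk, Function.comp_apply, real_inner_smul_left, h.inner_joining_tangent_left hx,
        real_inner_smul_right, h.derivWithin_inv_eq_inner hx]
      ring)
    ht (by rw [← h.derivWithin_inv_eq_inner ht, h0])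
  -- `N` has empty interior, so some point of `I` lies outside `N`
  obtain ⟨s, hsI, hsN⟩ : ∃ s ∈ I, s ∉ N := by
    by_contra! hIN
    have hne := (h.regular_φ.interval.interior_nonempty).mono (interior_mono hIN)
    rw [h.N_interior] at hne
    exact not_nonempty_empty hne
  have h1 := h.derivWithin_mul_inner_tangent hsI hsN
  have h2 := hzero (ρ s) (h.homeo.mapsTo hsI)
  rw [h.homeo.left_inv s hsI] at h2
  rw [h2, mul_zero] at h1
  exact zero_ne_one h1

lemma IsWMPair.N_eq_empty (h : IsWMPair J ψ I φ ρ σ M N) : N = ∅ :=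
  eq_empty_of_forall_notMem fun _ hs =>
    h.derivWithin_inv_ne_zero (h.homeo.mapsTo (h.N_subset hs)) (h.deriv_N _ (mem_image_of_mem ρ hs))

lemma IsWMPair.contDiffOn_rho (h : IsWMPair J ψ I φ ρ σ M N) : ContDiffOn ℝ ∞ ρ I := by
  have := h.smooth
  rwa [h.N_eq_empty, sdiff_empty] at this

/-! ### Frenet frames along the joining lines -/

/-- A Frenet frame of `φ` whose binormal is the unit joining vector. -/
lemma IsWMPair.exists_binormal_frame (h : IsWMPair J ψ I φ ρ σ M N) :
    ∃ (a : ℝ) (n b : ℝ → E3) (κ τ : ℝ → ℝ), a ≠ 0 ∧ IsFrenetFrame I φ n b κ τ ∧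
      ∀ s ∈ I, ψ (ρ s) - φ s = a • b s := by
  obtain ⟨a, ha, hnorm⟩ := h.exists_norm_joining_eq
  have hnorm' : ∀ s ∈ I, ‖ψ (ρ s) - φ s‖ = a := fun s hs => by
    have := hnorm (ρ s) (h.homeo.mapsTo hs)
    rwa [h.homeo.left_inv s hs] at this
  obtain ⟨n, b, κ, τ, hF, hb⟩ := h.regular_φ.exists_isFrenetFrame_binormal
    (b := fun s => a⁻¹ • (ψ (ρ s) - φ s))
    (((h.regular_ψ.smooth.comp h.contDiffOn_rho h.homeo.mapsTo).sub
      h.regular_φ.smooth).const_smul a⁻¹)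
    (fun s hs => by
      rw [norm_smul, hnorm' s hs, Real.norm_of_nonneg (inv_nonneg.2 ha.le), inv_mul_cancel₀ ha.ne'])
    (fun s hs => by rw [real_inner_smul_left, h.orth_φ s hs, mul_zero])
    (fun s hs => by rw [real_inner_smul_left, h.inner_modNormal hs, mul_zero])
  refine ⟨a, n, b, κ, τ, ha.ne', hF, fun s hs => ?_⟩
  rw [hb s hs, smul_smul, mul_inv_cancel₀ ha.ne', one_smul]

/-- A Frenet frame of `ψ` whose principal normal is the unit joining vector. -/
lemma IsWMPair.exists_normal_frame (h : IsWMPair J ψ I φ ρ σ M N) :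
    ∃ (n b : ℝ → E3) (κ τ : ℝ → ℝ), IsFrenetFrame J ψ n b κ τ ∧
      ∀ t ∈ J, ∃ c : ℝ, ψ t - φ (σ t) = c • n t := by
  obtain ⟨a, ha, hnorm⟩ := h.exists_norm_joining_eq
  have hw : ∀ t, ψ t - φ (σ t) = a • a⁻¹ • (ψ t - φ (σ t)) := fun t => by
    rw [smul_smul, mul_inv_cancel₀ ha.ne', one_smul]
  refine ⟨fun t => a⁻¹ • (ψ t - φ (σ t)), _, _, _, h.regular_ψ.isFrenetFrame
    ((h.regular_ψ.smooth.sub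
      (h.regular_φ.smooth.comp h.contDiffOn_inv h.homeo.mapsTo_inv)).const_smul a⁻¹)
    (fun t ht => ?_) (fun t ht => ?_) (fun t ht => ?_), fun t _ => ⟨a, hw t⟩⟩
  · rw [norm_smul, hnorm t ht, Real.norm_of_nonneg (inv_nonneg.2 ha.le), inv_mul_cancel₀ ha.ne']
  · rw [real_inner_smul_right, real_inner_comm, h.inner_joining_tangent_right ht, mul_zero]
  · obtain ⟨k, hk⟩ := h.exists_modNormal_eq_smul ht
    exact ⟨k * a, by rw [mul_smul, ← hw, hk]⟩

lemma IsWMPair.isFMConjugate (h : IsWMPair J ψ I φ ρ σ M N) : IsFMConjugate J ψ I φ ρ σ where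
  regular_φ := h.regular_φ
  regular_ψ := h.regular_ψ
  homeo := h.homeo
  smooth := h.contDiffOn_rho
  smooth_inv := h.contDiffOn_inv
  deriv_ne_zero s hs :=
    left_ne_zero_of_mul_eq_one (h.derivWithin_mul_inner_tangent hs (by simp [h.N_eq_empty]))
  distinct s hs := by
    have := h.joining_ne_zero (h.homeo.mapsTo hs)
    rwa [h.homeo.left_inv s hs, sub_ne_zero] at this
  frames := by
    obtain ⟨a, nφ, bφ, κφ, τφ, -, hφ, hb⟩ := h.exists_binormal_frame
    obtain ⟨nψ, bψ, κψ, τψ, hψ, hn⟩ := h.exists_normal_frame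
    refine ⟨nφ, bφ, nψ, bψ, κφ, τφ, κψ, τψ, hφ, hψ, fun s hs => ⟨⟨a, hb s hs⟩, ?_⟩⟩
    have := hn (ρ s) (h.homeo.mapsTo hs)
    rwa [h.homeo.left_inv s hs] at this

end WMPair

lemma IsFrenetFrame.modBinormal_eq {I : Set ℝ} {φ n b : ℝ → E3} {κ τ : ℝ → ℝ}
    (h : IsFrenetFrame I φ n b κ τ) {s : ℝ} (hs : s ∈ I) : modBinormal I φ s = κ s • b s := by
  rw [modBinormal, modNormal, h.deriv_T s hs, cross_smul, h.binormal_eq s hs]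

end Mannheim

theorem mainTheorem7 (I J : Set ℝ) (φ ψ : ℝ → Mannheim.E3) (ρ σ : ℝ → ℝ) (M N : Set ℝ)
    (hWM : Mannheim.IsWMPair J ψ I φ ρ σ M N)
    (hM : Mannheim.denseInItselfKernel M = ∅)
    (hN : Mannheim.denseInItselfKernel N = ∅) :
    Mannheim.IsFMCurve J ψ ∧ M = ∅ ∧ N = ∅ ∧
      ∃ (a : ℝ) (n b : ℝ → Mannheim.E3) (κ τ : ℝ → ℝ), a ≠ 0 ∧
        Mannheim.IsFrenetFrame I φ n b κ τ ∧
        (∀ s ∈ I, ψ (ρ s) = φ s + a • b s) ∧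
        (∀ s ∈ I, κ s ≠ 0 → ∀ d : ℝ,
          ψ (ρ s) = φ s + d • Mannheim.modBinormal I φ s ↔ d = a / κ s) := by
  obtain ⟨a, n, b, κ, τ, ha, hF, hb⟩ := hWM.exists_binormal_frame
  have hab : ∀ s ∈ I, ψ (ρ s) = φ s + a • b s := fun s hs => sub_eq_iff_eq_add'.1 (hb s hs)
  refine ⟨⟨I, φ, ρ, σ, hWM.isFMConjugate⟩, hWM.M_eq_empty, hWM.N_eq_empty,
    a, n, b, κ, τ, ha, hF, hab, fun s hs hκ d => ?_⟩
  have hb0 : b s ≠ 0 := by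
    have h1 := Mannheim.norm_cross (hWM.regular_φ.unit_speed s hs) (hF.norm_n s hs) (hF.orth s hs)
    rw [← hF.binormal_eq s hs] at h1
    exact norm_ne_zero_iff.1 (by rw [h1]; exact one_ne_zero)
  rw [hab s hs, hF.modBinormal_eq hs, add_right_inj, smul_smul, eq_div_iff hκ]
  exact ⟨fun h => (smul_left_injective ℝ hb0 h).symm, fun h => by rw [h]⟩
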